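/- Norms are Euclidean norms and induced matrix 2-norms. Let $\bar f_0:\mathbb R^n\to\mathbb R$, $\bar c_I:\mathbb R^n\to\mathbb R^q$ with $\bar g_0=\nabla\bar f_0$ and Jacobian $\bar J_I$, let $f_0,g_0,c_I,J_I$ be noisy versions of these functions, and fix $\mu,\omega>0$. For $z=(x,s)\in\mathbb R^n\times\mathbb R^q$ let $S=\mathrm{diag}(s)$, $f(z)=f_0(x)-\mu\sum_i\log s^{(i)}$, $c(z)=c_I(x)+s$, $g(z)=(g_0(x),-\mu e)$ with $e=(1,\dots,1)$, and $J(z)=[J_I(x)\ \ S]$; bars denote the same with noiseless functions, and an index $k$ denotes the value at $z_k$. **Algorithm.** Given parameters $\tau_{-1},\zeta>0$, $\sigma,\delta_\tau,\eta_s,\eta_\phi\in(0,1)$, the bounds $\epsilon_f,\epsilon_c$ below and $z_0$ with $s_0\ge0$, $c(z_0)\ge0$, iteration $k=0,1,\dots$ is as follows. (i) Stop if $J_k^Tc_k=0$ and $c_I(x_k)\not\le0$. (ii) The normal step $v_k$ minimizes $\frac12\|c_k+J_kv\|^2$ over $v\in\mathrm{range}(J_k^T)$ with $\|v\|\le\omega\|J_k^Tc_k\|$.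 (iii) Choose $W_k=\mathrm{diag}(H_k,\Sigma_k)$ with $H_k\in\mathbb R^{n\times n}$ symmetric and $\Sigma_k\in\mathbb R^{q\times q}$ diagonal and positive definite, and obtain $(d_k,y_{k+1})$ from $W_kd_k+J_k^Ty_{k+1}=-g_k$, $J_kd_k=J_kv_k$. The tangential step is $u_k=d_k-v_k$; write $d_k=(d_k^x,d_k^s)$. (iv) Stop if $J_k^Tc_k=0$ and $g_k+J_k^Ty_{k+1}=0$. (v) With $\tau_k^{\rm trial}=\infty$ if $g_k^Td_k+\frac12u_k^TW_ku_k\le0$ and $\tau_k^{\rm trial}=\frac{(1-\sigma)(\|c_k\|-\|c_k+J_kv_k\|)}{g_k^Td_k+\frac12u_k^TW_ku_k}$ otherwise, let $\tau_k=\tau_{k-1}$ if $\tau_{k-1}\le\tau_k^{\rm trial}$ and $\tau_k=\min\{(1-\delta_\tau)\tau_{k-1},\tau_k^{\rm trial}\}$ otherwise. (vi) Let $\alpha_k^{\max}$ be the largest $\alpha\in(0,1]$ with $s_k+\alpha S_kd_k^s\ge(1-\eta_s)s_k$, and $\alpha_k=2^{-j}\alpha_k^{\max}$ with the least $j\in\{0,1,\dots\}$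 such that, with $\phi(z,\tau)=\tau f(z)+\|c(z)\|$ and $\Delta m_k=-\tau_kg_k^Td_k+\|c_k\|-\|c_k+J_kd_k\|$, $$\phi\big((x_k+\alpha_kd_k^x,\ s_k+\alpha_kS_kd_k^s),\tau_k\big)\le\phi(z_k,\tau_k)-\eta_\phi\alpha_k\Delta m_k+(2+\zeta)(\tau_k\epsilon_f+\epsilon_c).$$ (vii) Let $x_{k+1}=x_k+\alpha_kd_k^x$ and $s_{k+1}=\max\{s_k+\alpha_kS_kd_k^s,-c_I(x_{k+1})\}$ componentwise. Consider a run that does not terminate. Let $\bar v_k,\bar d_k,\bar y_{k+1}$ be what (ii)–(iii) give at the same iterate $z_k$, with the same $W_k$, from $\bar c_k,\bar J_k,\bar g_k$, and let $\bar u_k=\bar d_k-\bar v_k$. **Assumptions**, with constants $c_{\sup},g_{\sup},J_{\sup},s_{\sup},\sigma_W,\kappa_W,\gamma>0$ and noise bounds $\epsilon_f,\epsilon_g,\epsilon_c,\epsilon_J>0$, $\epsilon_J<\gamma$: 1. All $x_k$ lie in an open convex set $\mathcal X$ on which $\bar f_0$ and $\bar c_I$ are continuously differentiable, $\bar f_0$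 is bounded below, $\bar g_0$ and $\bar J_I$ are Lipschitz continuous, $\|\bar c_I\|\le c_{\sup}$, $\|\bar g_0\|\le g_{\sup}$, $\|\bar J_I\|\le J_{\sup}$, and $|\bar f_0-f_0|\le\epsilon_f$, $\|\bar g_0-g_0\|\le\epsilon_g$, $\|\bar c_I-c_I\|\le\epsilon_c$, $\|\bar J_I-J_I\|\le\epsilon_J$. 2. For all $k$: the linear system in (iii) has a unique solution both with $(J_k,g_k,v_k)$ and with $(\bar J_k,\bar g_k,\bar v_k)$; $p^TW_kp\ge\sigma_W\|p\|^2$ for all $p\in\mathrm{null}(J_k)\cup\mathrm{null}(\bar J_k)$; and $\|W_k\|\le\kappa_W$. 3. $\|s_k\|\le s_{\sup}$ for all $k$. 4. There is $k_J\in\mathbb N$ with $\sigma_{\min}(J_k)\ge\gamma$ for all $k\ge k_J$. 5. There are $\lambda\ge0$ and $\sigma_\Gamma>0$ such that, for all $k$, $\Gamma_k=W_k+\lambda J_k^TJ_k$ and $\bar\Gamma_k=W_k+\lambda\bar J_k^T\bar J_k$ are positive definite with smallest singular values at least $\sigma_\Gamma$, and for all $k\ge k_J$ $$\|(\bar J_k\bar\Gamma_k^{-1}\bar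 J_k^T)^{-1}\|\big(\|\bar J_k\|\|\Gamma_k^{-1}J_k^T-\bar\Gamma_k^{-1}\bar J_k^T\|+\|\bar\Gamma_k^{-1}\bar J_k^T\|\epsilon_J+\|\Gamma_k^{-1}J_k^T-\bar\Gamma_k^{-1}\bar J_k^T\|\epsilon_J\big)<1.$$ **Claim.** For all $n,q,\mu,\omega,c_{\sup},g_{\sup},J_{\sup},s_{\sup},\sigma_W,\kappa_W,\gamma$ there are nonnegative functions $\epsilon_v(\epsilon_c,\epsilon_J)$, $\epsilon_u(\epsilon_c,\epsilon_J,\epsilon_g)$ and $\epsilon_d(\epsilon_c,\epsilon_J,\epsilon_g)=\epsilon_v(\epsilon_c,\epsilon_J)+\epsilon_u(\epsilon_c,\epsilon_J,\epsilon_g)$, which tend to $0$ as their arguments tend to $0$ through positive values, such that for all problem functions, noisy functions, noise bounds, parameters and nonterminating runs of the algorithm as above: (a) under Assumptions 1–4, $\|\bar v_k-v_k\|\le\epsilon_v(\epsilon_c,\epsilon_J)$ for all $k\ge k_J$; (b) under Assumptions 1–5, $\|u_k-\bar u_k\|\le\epsilon_u(\epsilon_c,\epsilon_J,\epsilon_g)$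 for all $k\ge k_J$; (c) under Assumptions 1–5, $\|d_k-\bar d_k\|\le\epsilon_d(\epsilon_c,\epsilon_J,\epsilon_g)$ for all $k\ge k_J$. -/

import Mathlib

open Set Filter Topology
open scoped NNReal InnerProduct InnerProductSpace

noncomputable section

namespace NoisyIPM

/-! Matrices are identified with continuous linear maps between Euclidean spaces: the transpose is
the adjoint, the norm is the induced 2-norm. -/

/-- `ℝᵐ` with the 2-norm. -/
abbrev Vec (m : ℕ) := EuclideanSpace ℝ (Fin m)

/-- `ℝⁿ⁺q` with the 2-norm, as pairs `(x, s)` with `x ∈ ℝⁿ` and `s ∈ ℝ^q`. -/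
abbrev ZVec (n q : ℕ) := WithLp 2 (Vec n × Vec q)

/-- The diagonal matrix `diag(s)`. -/
def diagOp {q : ℕ} (s : Vec q) : Vec q →L[ℝ] Vec q :=
  Matrix.toEuclideanCLM (𝕜 := ℝ) (Matrix.diagonal s.ofLp)

/-- The block row `[A  B]`. -/
def blockRow {n q : ℕ} (A : Vec n →L[ℝ] Vec q) (B : Vec q →L[ℝ] Vec q) : ZVec n q →L[ℝ] Vec q :=
  A ∘L WithLp.fstL 2 ℝ (Vec n) (Vec q) + B ∘L WithLp.sndL 2 ℝ (Vec n) (Vec q)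

/-- The block diagonal matrix with diagonal blocks `H` and `B`. -/
def blockDiag {n q : ℕ} (H : Vec n →L[ℝ] Vec n) (B : Vec q →L[ℝ] Vec q) :
    ZVec n q →L[ℝ] ZVec n q :=
  (WithLp.prodContinuousLinearEquiv 2 ℝ (Vec n) (Vec q)).symm.toContinuousLinearMap ∘L
    ((H ∘L WithLp.fstL 2 ℝ (Vec n) (Vec q)).prod (B ∘L WithLp.sndL 2 ℝ (Vec n) (Vec q)))

/-- `σ_min(T) ≥ γ`: each of the `min (dim E) (dim F)` singular values of `T : E → F` is at
least `γ` (Mathlib's sequence of singular values is decreasing and padded by zeros). -/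
def SigmaMinGE {E F : Type*} [NormedAddCommGroup E] [InnerProductSpace ℝ E] [FiniteDimensional ℝ E]
    [NormedAddCommGroup F] [InnerProductSpace ℝ F] [FiniteDimensional ℝ F]
    (T : E →L[ℝ] F) (γ : ℝ) : Prop :=
  ∀ i < min (Module.finrank ℝ E) (Module.finrank ℝ F), γ ≤ (T : E →ₗ[ℝ] F).singularValues i

/-! ### Function evaluations and the barrier problem -/

/-- What is returned for the objective, its gradient, the constraint function and its Jacobian. -/
structure Evals (n q : ℕ) where
  f0 : Vec n → ℝ
  g0 : Vec n → Vec n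
  cI : Vec n → Vec q
  JI : Vec n → (Vec n →L[ℝ] Vec q)

/-- The noiseless evaluations for the objective `fbar0` and the constraint function `cbarI`. -/
def Evals.exact {n q : ℕ} (fbar0 : Vec n → ℝ) (cbarI : Vec n → Vec q) : Evals n q where
  f0 := fbar0
  g0 := gradient fbar0
  cI := cbarI
  JI := fderiv ℝ cbarI

namespace Evals

variable {n q : ℕ} (F : Evals n q)

/-- Barrier objective `f₀(x) - μ ∑ log s⁽ⁱ⁾`. -/
def f (μ : ℝ) (x : Vec n) (s : Vec q) : ℝ := F.f0 x - μ * ∑ i, Real.log (s i)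

/-- Slack form of the constraint function, `c_I(x) + s`. -/
def c (x : Vec n) (s : Vec q) : Vec q := F.cI x + s

/-- Scaled gradient `(g₀(x), -μ e)`. -/
def g (μ : ℝ) (x : Vec n) : ZVec n q := WithLp.toLp 2 (F.g0 x, WithLp.toLp 2 (fun _ => -μ))

/-- Scaled Jacobian `[J_I(x)  diag(s)]`. -/
def J (x : Vec n) (s : Vec q) : ZVec n q →L[ℝ] Vec q := blockRow (F.JI x) (diagOp s)

/-- Merit function `τ f(z) + ‖c(z)‖`. -/
def merit (μ τ : ℝ) (x : Vec n) (s : Vec q) : ℝ := τ * F.f μ x s + ‖F.c x s‖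

end Evals

/-! ### Subproblems -/

/-- `v` solves `min ½‖c + J v‖²` over `v ∈ range(Jᵀ)` subject to `‖v‖ ≤ ω ‖Jᵀ c‖`. -/
def IsNormalStep {n q : ℕ} (ω : ℝ) (c : Vec q) (J : ZVec n q →L[ℝ] Vec q) (v : ZVec n q) : Prop :=
  IsMinOn (fun w => (1 / 2 : ℝ) * ‖c + J w‖ ^ 2)
      {w | w ∈ range (J†) ∧ ‖w‖ ≤ ω * ‖(J†) c‖} v ∧
    v ∈ range (J†) ∧ ‖v‖ ≤ ω * ‖(J†) c‖

/-- `(d, y)` solves the linear system `W d + Jᵀ y = -g`, `J d = J v`. -/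
def SolvesNewton {n q : ℕ} (W : ZVec n q →L[ℝ] ZVec n q) (J : ZVec n q →L[ℝ] Vec q)
    (g v d : ZVec n q) (y : Vec q) : Prop :=
  W d + (J†) y = -g ∧ J d = J v

/-! ### The algorithm -/

/-- Prescribed constants of the algorithm other than `μ` and `ω`. -/
structure Params where
  tauInit : ℝ
  sigma : ℝ
  deltaTau : ℝ
  etaS : ℝ
  etaPhi : ℝ
  zeta : ℝ
  tauInit_pos : 0 < tauInit
  sigma_mem : sigma ∈ Ioo (0 : ℝ) 1
  deltaTau_mem : deltaTau ∈ Ioo (0 : ℝ) 1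
  etaS_mem : etaS ∈ Ioo (0 : ℝ) 1
  etaPhi_mem : etaPhi ∈ Ioo (0 : ℝ) 1
  zeta_pos : 0 < zeta

/-- Merit parameter update. `curv` stands for `gᵀd + ½ uᵀWu` and `red` for `‖c‖ - ‖c + J v‖`; the
trial value is `∞` if `curv ≤ 0`, and `(1 - σ) red / curv` otherwise. -/
def tauUpdate (P : Params) (tauPrev curv red : ℝ) : ℝ :=
  if curv ≤ 0 then tauPrev
  else if tauPrev ≤ (1 - P.sigma) * red / curv then tauPrev
  else min ((1 - P.deltaTau) * tauPrev) ((1 - P.sigma) * red / curv)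

/-- The sequences produced by a nonterminating run. `W_k` has diagonal blocks `H k` and
`diag (Sig k)`. -/
structure Iterates (n q : ℕ) where
  x : ℕ → Vec n
  s : ℕ → Vec q
  y : ℕ → Vec q
  v : ℕ → ZVec n q
  d : ℕ → ZVec n q
  H : ℕ → (Vec n →L[ℝ] Vec n)
  Sig : ℕ → Vec q
  tau : ℕ → ℝ
  alphaMax : ℕ → ℝ
  alpha : ℕ → ℝ

namespace Iterates

variable {n q : ℕ} (it : Iterates n q)

/-- The matrix `W_k`. -/
def W (k : ℕ) : ZVec n q →L[ℝ] ZVec n q := blockDiag (it.H k) (diagOp (it.Sig k))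

/-- The tangential step `u_k`. -/
def u (k : ℕ) : ZVec n q := it.d k - it.v k

/-- `τ_{k-1}`. -/
def tauPrev (P : Params) : ℕ → ℝ
  | 0 => P.tauInit
  | k + 1 => it.tau k

/-- The slack `s_k + α S_k d_k^s`. -/
def trialSlack (k : ℕ) (α : ℝ) : Vec q := it.s k + α • diagOp (it.s k) (it.d k).snd

/-- The values of `c`, `g`, `J` at the `k`th iterate. -/
def c (F : Evals n q) (k : ℕ) : Vec q := F.c (it.x k) (it.s k)

def g (F : Evals n q) (μ : ℝ) (k : ℕ) : ZVec n q := F.g μ (it.x k)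

def J (F : Evals n q) (k : ℕ) : ZVec n q →L[ℝ] Vec q := F.J (it.x k) (it.s k)

/-- Model reduction `Δm_k(d_k, τ_k)`. -/
def modelRed (F : Evals n q) (μ : ℝ) (k : ℕ) : ℝ :=
  -it.tau k * ⟪it.g F μ k, it.d k⟫_ℝ + ‖it.c F k‖ - ‖it.c F k + it.J F k (it.d k)‖

/-- The relaxed Armijo condition for the step size `α` in iteration `k`. -/
def Armijo (F : Evals n q) (P : Params) (μ εf εc : ℝ) (k : ℕ) (α : ℝ) : Prop :=
  F.merit μ (it.tau k) (it.x k + α • (it.d k).fst) (it.trialSlack k α) ≤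
    F.merit μ (it.tau k) (it.x k) (it.s k) - P.etaPhi * α * it.modelRed F μ k
      + (2 + P.zeta) * (it.tau k * εf + εc)

/-- `it` is a run of the algorithm, with evaluations `F`, that never terminates. -/
structure IsRun (F : Evals n q) (P : Params) (μ ω εf εc : ℝ) : Prop where
  slack_init : ∀ i, 0 ≤ it.s 0 i
  con_init : ∀ i, 0 ≤ it.c F 0 i
  no_stop_infeasible : ∀ k, ¬ (((it.J F k)†) (it.c F k) = 0 ∧ ¬ ∀ i, F.cI (it.x k) i ≤ 0)
  normal : ∀ k, IsNormalStep ω (it.c F k) (it.J F k) (it.v k)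
  H_symm : ∀ k, IsSelfAdjoint (it.H k)
  Sig_pos : ∀ k i, 0 < it.Sig k i
  newton : ∀ k, SolvesNewton (it.W k) (it.J F k) (it.g F μ k) (it.v k) (it.d k) (it.y (k + 1))
  no_stop_stationary : ∀ k, ¬ (((it.J F k)†) (it.c F k) = 0 ∧
    it.g F μ k + ((it.J F k)†) (it.y (k + 1)) = 0)
  tau_eq : ∀ k, it.tau k = tauUpdate P (it.tauPrev P k)
    (⟪it.g F μ k, it.d k⟫_ℝ + 1 / 2 * ⟪it.u k, it.W k (it.u k)⟫_ℝ)
    (‖it.c F k‖ - ‖it.c F k + it.J F k (it.v k)‖)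
  alphaMax_greatest : ∀ k, IsGreatest
    {α : ℝ | α ∈ Ioc (0 : ℝ) 1 ∧ ∀ i, (1 - P.etaS) * it.s k i ≤ it.trialSlack k α i}
    (it.alphaMax k)
  alpha_least : ∀ k, ∃ j : ℕ,
    IsLeast {j : ℕ | it.Armijo F P μ εf εc k ((1 / 2) ^ j * it.alphaMax k)} j ∧
    it.alpha k = (1 / 2) ^ j * it.alphaMax k
  x_next : ∀ k, it.x (k + 1) = it.x k + it.alpha k • (it.d k).fst
  s_next : ∀ k i, it.s (k + 1) i = max (it.trialSlack k (it.alpha k) i) (-F.cI (it.x (k + 1)) i)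

end Iterates

/-- The steps that the noiseless values would give at the same iterates, with the same `W_k`. -/
structure NoiselessSteps (n q : ℕ) where
  v : ℕ → ZVec n q
  d : ℕ → ZVec n q
  y : ℕ → Vec q

namespace NoiselessSteps

variable {n q : ℕ} (st : NoiselessSteps n q)

/-- The noiseless tangential step. -/
def u (k : ℕ) : ZVec n q := st.d k - st.v k

/-- `Fbar` are the noiseless evaluations. -/
structure AreFor (it : Iterates n q) (Fbar : Evals n q) (μ ω : ℝ) : Prop where
  normal : ∀ k, IsNormalStep ω (it.c Fbar k) (it.J Fbar k) (st.v k)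
  newton : ∀ k,
    SolvesNewton (it.W k) (it.J Fbar k) (it.g Fbar μ k) (st.v k) (st.d k) (st.y (k + 1))

end NoiselessSteps

/-! ### Assumptions -/

section Assumptions

variable {n q : ℕ}

/-- Smoothness and boundedness of the problem functions over a set `X` that contains the iterates,
and noise bounds over `X`. -/
structure RegularWithNoise (X : Set (Vec n)) (fbar0 : Vec n → ℝ) (cbarI : Vec n → Vec q)
    (F : Evals n q) (it : Iterates n q) (cSup gSup JSup εf εg εc εJ : ℝ) : Prop where
  isOpen : IsOpen X
  convex : Convex ℝ X
  mem : ∀ k, it.x k ∈ X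
  f_smooth : ContDiffOn ℝ 1 fbar0 X
  c_smooth : ContDiffOn ℝ 1 cbarI X
  f_below : BddBelow (fbar0 '' X)
  c_bound : ∀ x ∈ X, ‖cbarI x‖ ≤ cSup
  g_lipschitz : ∃ L : ℝ≥0, LipschitzOnWith L (gradient fbar0) X
  J_lipschitz : ∃ L : ℝ≥0, LipschitzOnWith L (fderiv ℝ cbarI) X
  g_bound : ∀ x ∈ X, ‖gradient fbar0 x‖ ≤ gSup
  J_bound : ∀ x ∈ X, ‖fderiv ℝ cbarI x‖ ≤ JSup
  f_noise : ∀ x ∈ X, |fbar0 x - F.f0 x| ≤ εf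
  g_noise : ∀ x ∈ X, ‖gradient fbar0 x - F.g0 x‖ ≤ εg
  c_noise : ∀ x ∈ X, ‖cbarI x - F.cI x‖ ≤ εc
  J_noise : ∀ x ∈ X, ‖fderiv ℝ cbarI x - F.JI x‖ ≤ εJ

/-- The requirements on the matrices `W_k`. -/
structure MatricesOK (F Fbar : Evals n q) (it : Iterates n q) (st : NoiselessSteps n q)
    (μ σW κW : ℝ) : Prop where
  unique_noisy : ∀ k, ∃! p : ZVec n q × Vec q,
    SolvesNewton (it.W k) (it.J F k) (it.g F μ k) (it.v k) p.1 p.2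
  unique_noiseless : ∀ k, ∃! p : ZVec n q × Vec q,
    SolvesNewton (it.W k) (it.J Fbar k) (it.g Fbar μ k) (st.v k) p.1 p.2
  pos_null : ∀ k p, it.J F k p = 0 ∨ it.J Fbar k p = 0 → σW * ‖p‖ ^ 2 ≤ ⟪p, it.W k p⟫_ℝ
  norm_le : ∀ k, ‖it.W k‖ ≤ κW

/-- The matrix `W_k + lam J_kᵀ J_k` for the evaluations `F`. -/
def Gam (F : Evals n q) (it : Iterates n q) (lam : ℝ) (k : ℕ) : ZVec n q →L[ℝ] ZVec n q :=
  it.W k + lam • ((it.J F k)† ∘L it.J F k)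

/-- The noise in the Jacobians is small relative to `Γ_k = W_k + lam J_kᵀ J_k` and its noiseless
counterpart, where `lam ≥ 0` makes all these matrices uniformly positive definite. -/
def SmallJacobianNoise (F Fbar : Evals n q) (it : Iterates n q) (εJ : ℝ) (kJ : ℕ) : Prop :=
  ∃ lam : ℝ, 0 ≤ lam ∧
    (∃ σΓ : ℝ, 0 < σΓ ∧ ∀ k, ∀ E ∈ ({F, Fbar} : Set (Evals n q)),
      (∀ p, p ≠ 0 → 0 < ⟪p, Gam E it lam k p⟫_ℝ) ∧ SigmaMinGE (Gam E it lam k) σΓ) ∧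
    ∀ k ≥ kJ,
      let Jk := it.J F k
      let Jbar := it.J Fbar k
      let GJ := (Gam F it lam k).inverse ∘L Jk†
      let GJbar := (Gam Fbar it lam k).inverse ∘L Jbar†
      ‖(Jbar ∘L GJbar).inverse‖ *
        (‖Jbar‖ * ‖GJ - GJbar‖ + ‖GJbar‖ * εJ + ‖GJ - GJbar‖ * εJ) < 1

end Assumptions

end NoisyIPM

end

namespace NoisyIPM

section General

variable {E F : Type*} [NormedAddCommGroup E] [InnerProductSpace ℝ E] [FiniteDimensional ℝ E]
  [NormedAddCommGroup F] [InnerProductSpace ℝ F] [FiniteDimensional ℝ F]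

theorem SigmaMinGE.le_norm_adjoint {T : E →L[ℝ] F} {γ : ℝ} (hγ : 0 < γ) (h : SigmaMinGE T γ)
    (hdim : Module.finrank ℝ F ≤ Module.finrank ℝ E) (y : F) : γ * ‖y‖ ≤ ‖(T†) y‖ := by
  let L : E →ₗ[ℝ] F := T
  let e := L.isSymmetric_adjoint_comp_self.eigenvectorBasis rfl
  let i' : Fin (Module.finrank ℝ F) → Fin (Module.finrank ℝ E) := Fin.castLE hdim
  let σ : Fin (Module.finrank ℝ F) → ℝ := fun i => L.singularValues i
  have hσ : ∀ i, γ ≤ σ i := fun i => h i (by simp [hdim])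
  have hσ0 : ∀ i, 0 < σ i := fun i => hγ.trans_le (hσ i)
  have hinner : ∀ i j, ⟪T (e (i' i)), T (e (i' j))⟫_ℝ = if i = j then σ i ^ 2 else 0 := by
    intro i j
    have h1 : (L.adjoint ∘ₗ L) (e (i' j)) = (σ j ^ 2) • e (i' j) := by
      have := L.isSymmetric_adjoint_comp_self.apply_eigenvectorBasis rfl (i' j)
      rw [← L.sq_singularValues_fin rfl] at this
      exact this
    have h2 : ⟪T (e (i' i)), T (e (i' j))⟫_ℝ = ⟪e (i' i), (L.adjoint ∘ₗ L) (e (i' j))⟫_ℝ := by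
      rw [LinearMap.comp_apply, LinearMap.adjoint_inner_right]; rfl
    rw [h2, h1, inner_smul_right, e.inner_eq_ite]
    by_cases hij : i = j
    · simp [hij]
    · have : i' i ≠ i' j := fun hc => hij (Fin.castLE_injective hdim hc)
      simp [hij, this]
  let f : Fin (Module.finrank ℝ F) → F := fun i => (σ i)⁻¹ • T (e (i' i))
  have hf : Orthonormal ℝ f := by
    rw [orthonormal_iff_ite]
    intro i j
    simp only [f, inner_smul_left, inner_smul_right, hinner]
    by_cases hij : i = j
    · subst hij
      have := (hσ0 i).ne'
      simp; field_simp
    · simp [hij]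
  let b : OrthonormalBasis (Fin (Module.finrank ℝ F)) ℝ F :=
    OrthonormalBasis.mk hf
      (hf.linearIndependent.span_eq_top_of_card_eq_finrank' (by simp)).ge
  have hb : ∀ i, b i = f i := fun i => by simp [b]
  have hcoef : ∀ i, ⟪e (i' i), (T†) y⟫_ℝ = σ i * ⟪b i, y⟫_ℝ := by
    intro i
    have := (hσ0 i).ne'
    rw [ContinuousLinearMap.adjoint_inner_right, hb, inner_smul_left]
    simp; field_simp
  have hbess := (e.orthonormal.comp i' (Fin.castLE_injective hdim)).sum_inner_products_le
    ((T†) y) (s := Finset.univ)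
  have hsq : (γ * ‖y‖) ^ 2 ≤ ‖(T†) y‖ ^ 2 := by
    refine le_trans ?_ hbess
    rw [mul_pow, ← b.sum_sq_norm_inner_right y, Finset.mul_sum]
    refine Finset.sum_le_sum fun i _ => ?_
    rw [Function.comp_apply, hcoef, norm_mul, mul_pow, Real.norm_of_nonneg (hσ0 i).le]
    have := hσ i
    gcongr
  exact le_of_sq_le_sq hsq (norm_nonneg _)

theorem norm_adjoint_sub_apply_le {T S : E →L[ℝ] F} {ε : ℝ} (h : ‖T - S‖ ≤ ε) (y : F) :
    ‖(T†) y - (S†) y‖ ≤ ε * ‖y‖ := by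
  have h1 : (T†) y - (S†) y = ((T - S)†) y := by simp
  rw [h1]
  refine (ContinuousLinearMap.le_opNorm _ _).trans ?_
  rw [LinearIsometryEquiv.norm_map]
  gcongr

theorem norm_adjoint_apply_le {T : E →L[ℝ] F} {M : ℝ} (h : ‖T‖ ≤ M) (y : F) :
    ‖(T†) y‖ ≤ M * ‖y‖ := by
  refine (ContinuousLinearMap.le_opNorm _ _).trans ?_
  rw [LinearIsometryEquiv.norm_map]
  gcongr

/-- A map whose adjoint is bounded below is bounded below on the range of its adjoint. -/
theorem le_norm_apply_adjoint {T : E →L[ℝ] F} {a : ℝ}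
    (h : ∀ y, a * ‖y‖ ≤ ‖(T†) y‖) (y : F) : a * ‖(T†) y‖ ≤ ‖T ((T†) y)‖ := by
  rcases (norm_nonneg y).eq_or_lt with hy | hy
  · have : y = 0 := norm_eq_zero.1 hy.symm
    simp [this]
  · have h1 : ‖(T†) y‖ * ‖(T†) y‖ ≤ ‖T ((T†) y)‖ * ‖y‖ := by
      rw [← real_inner_self_eq_norm_mul_norm, ContinuousLinearMap.adjoint_inner_right]
      exact real_inner_le_norm _ _
    have h2 := mul_le_mul_of_nonneg_right (h y) (norm_nonneg ((T†) y))
    exact le_of_mul_le_mul_right (by linarith) hy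

/-- A map whose adjoint is bounded below has a bounded right inverse. -/
theorem exists_preimage_norm_le {T : E →L[ℝ] F} {a : ℝ} (ha : 0 < a)
    (h : ∀ y, a * ‖y‖ ≤ ‖(T†) y‖) (z : F) : ∃ r, T r = z ∧ a * ‖r‖ ≤ ‖z‖ := by
  let A : F →ₗ[ℝ] F := (T ∘L T† : F →L[ℝ] F)
  have hinj : Function.Injective A := by
    rw [injective_iff_map_eq_zero]
    intro y hy
    have hy' : T ((T†) y) = 0 := hy
    have h1 := le_norm_apply_adjoint h y
    have h2 := h y
    rw [hy', norm_zero] at h1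
    have h3 : ‖(T†) y‖ = 0 := by nlinarith [norm_nonneg ((T†) y)]
    rw [h3] at h2
    exact norm_eq_zero.1 (by nlinarith [norm_nonneg y])
  obtain ⟨y, hy⟩ := LinearMap.injective_iff_surjective.1 hinj z
  have hy' : T ((T†) y) = z := hy
  exact ⟨(T†) y, hy', hy' ▸ le_norm_apply_adjoint h y⟩

omit [FiniteDimensional ℝ E] in
theorem exists_smul_norm_le (w : E) {Δ : ℝ} (hΔ : 0 ≤ Δ) {η : ℝ} (hη : 0 ≤ η) (h : ‖w‖ ≤ Δ + η) :
    ∃ t : ℝ, ‖t • w‖ ≤ Δ ∧ ‖t • w - w‖ ≤ η := by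
  by_cases hw : ‖w‖ ≤ Δ
  · exact ⟨1, by simpa using hw, by simpa using hη⟩
  · push Not at hw
    have hw0 : 0 < ‖w‖ := hΔ.trans_lt hw
    refine ⟨Δ / ‖w‖, ?_, ?_⟩
    · rw [norm_smul, Real.norm_of_nonneg (by positivity)]
      field_simp; rfl
    · have h1 : (Δ / ‖w‖) • w - w = (Δ / ‖w‖ - 1) • w := by rw [sub_smul, one_smul]
      have h2 : Δ / ‖w‖ - 1 ≤ 0 := by rw [sub_nonpos, div_le_one hw0]; exact hw.le
      rw [h1, norm_smul, Real.norm_of_nonpos h2]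
      have : -(Δ / ‖w‖ - 1) * ‖w‖ = ‖w‖ - Δ := by field_simp; ring
      linarith

end General

section Steps

variable {n q : ℕ}

theorem IsNormalStep.norm_le {ω : ℝ} {c : Vec q} {J : ZVec n q →L[ℝ] Vec q} {v : ZVec n q}
    (h : IsNormalStep ω c J v) (hω : 0 ≤ ω) {M C : ℝ} (hJ : ‖J‖ ≤ M) (hc : ‖c‖ ≤ C) :
    ‖v‖ ≤ ω * (M * C) := by
  have hM : 0 ≤ M := (norm_nonneg J).trans hJ
  refine h.2.2.trans ?_
  have := norm_adjoint_apply_le hJ c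
  gcongr
  exact this.trans (by gcongr)

theorem IsNormalStep.norm_residual_le {ω : ℝ} {c : Vec q} {J : ZVec n q →L[ℝ] Vec q}
    {v w : ZVec n q} (h : IsNormalStep ω c J v) (hw : w ∈ range (J†))
    (hw' : ‖w‖ ≤ ω * ‖(J†) c‖) : ‖c + J v‖ ≤ ‖c + J w‖ := by
  have h1 : (1 / 2 : ℝ) * ‖c + J v‖ ^ 2 ≤ 1 / 2 * ‖c + J w‖ ^ 2 := h.1 ⟨hw, hw'⟩
  exact le_of_sq_le_sq (by linarith) (norm_nonneg _)

/-- The objective of the normal step subproblem grows quadratically away from the minimizer. -/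
theorem IsNormalStep.sq_norm_apply_sub_le {ω : ℝ} {c : Vec q} {J : ZVec n q →L[ℝ] Vec q}
    {v w : ZVec n q} (h : IsNormalStep ω c J v) (hw : w ∈ range (J†))
    (hw' : ‖w‖ ≤ ω * ‖(J†) c‖) :
    ‖J (w - v)‖ ^ 2 ≤ 2 * (‖c + J w‖ ^ 2 - ‖c + J v‖ ^ 2) := by
  obtain ⟨y, hy⟩ := h.2.1
  obtain ⟨z, hz⟩ := hw
  have hmid : ‖c + J v‖ ≤ ‖c + J ((1 / 2 : ℝ) • (w + v))‖ := by
    refine h.norm_residual_le ⟨(1 / 2 : ℝ) • (z + y), by rw [map_smul, map_add, hy, hz]⟩ ?_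
    rw [norm_smul]
    have := norm_add_le w v
    have := h.2.2
    norm_num
    linarith
  have h1 : (2 : ℝ) • (c + J ((1 / 2 : ℝ) • (w + v))) = (c + J w) + (c + J v) := by
    rw [map_smul, map_add, smul_add, smul_smul]; norm_num; module
  have h2 : J (w - v) = (c + J w) - (c + J v) := by rw [map_sub]; abel
  have h3 := parallelogram_law_with_norm ℝ (c + J w) (c + J v)
  rw [← h1, ← h2, norm_smul, Real.norm_of_nonneg (by norm_num)] at h3
  have h4 : ‖c + J v‖ ^ 2 ≤ ‖c + J ((1 / 2 : ℝ) • (w + v))‖ ^ 2 := by gcongr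
  nlinarith

/-- A point of the feasible set of one normal step subproblem is close to that of another. -/
theorem exists_mem_range_adjoint_near {J J' : ZVec n q →L[ℝ] Vec q} {a εJ V Δ' δ : ℝ}
    {v : ZVec n q} (ha : 0 < a) (hJ : ∀ y, a * ‖y‖ ≤ ‖(J†) y‖) (hJJ : ‖J - J'‖ ≤ εJ)
    (hv : v ∈ range (J†)) (hV : ‖v‖ ≤ V) (hΔ' : 0 ≤ Δ') (hδ : 0 ≤ δ) (hvΔ : ‖v‖ ≤ Δ' + δ) :
    ∃ w ∈ range (J'†), ‖w‖ ≤ Δ' ∧ ‖w - v‖ ≤ δ + 2 * (εJ * V / a) := by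
  obtain ⟨y, rfl⟩ := hv
  have hε : 0 ≤ εJ := (norm_nonneg _).trans hJJ
  have hV0 : 0 ≤ V := (norm_nonneg _).trans hV
  have h1 : ‖(J†) y - (J'†) y‖ ≤ εJ * V / a := by
    refine (norm_adjoint_sub_apply_le hJJ y).trans ?_
    rw [mul_div_assoc]
    gcongr
    rw [le_div_iff₀ ha]
    linarith [hJ y]
  have h2 : ‖(J'†) y‖ ≤ Δ' + (δ + εJ * V / a) := by
    have := norm_sub_norm_le ((J'†) y) ((J†) y)
    rw [norm_sub_rev] at this
    linarith
  obtain ⟨t, ht1, ht2⟩ := exists_smul_norm_le ((J'†) y) hΔ' (by positivity) h2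
  refine ⟨t • (J'†) y, ⟨t • y, by rw [map_smul]⟩, ht1, ?_⟩
  have h3 := norm_sub_le_norm_sub_add_norm_sub (t • (J'†) y) ((J'†) y) ((J†) y)
  rw [norm_sub_rev ((J'†) y)] at h3
  linarith

/-- Bound for the distance between feasible points of two normal step subproblems. -/
noncomputable def normalDist (ω a M C εc εJ : ℝ) : ℝ :=
  ω * (M * εc + εJ * C) + 2 * (εJ * (ω * (M * C)) / a)

/-- Bound for the distance between residuals of two normal step subproblems. -/
noncomputable def residualDist (ω a M C εc εJ : ℝ) : ℝ :=
  εc + M * normalDist ω a M C εc εJ + εJ * (ω * (M * C))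

/-- Bound for the distance between the solutions of two normal step subproblems. -/
noncomputable def normalBound (ω a M C εc εJ : ℝ) : ℝ :=
  normalDist ω a M C εc εJ +
    √(8 * residualDist ω a M C εc εJ * (residualDist ω a M C εc εJ + C)) / a

theorem radius_sub_le {c c' : Vec q} {J J' : ZVec n q →L[ℝ] Vec q} {ω M C εc εJ : ℝ}
    (hω : 0 ≤ ω) (hc' : ‖c'‖ ≤ C) (hJ : ‖J‖ ≤ M) (hcc : ‖c - c'‖ ≤ εc) (hJJ : ‖J - J'‖ ≤ εJ) :
    ω * ‖(J†) c‖ ≤ ω * ‖(J'†) c'‖ + ω * (M * εc + εJ * C) := by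
  have hM : 0 ≤ M := (norm_nonneg J).trans hJ
  have hε : 0 ≤ εJ := (norm_nonneg _).trans hJJ
  have h1 : (J†) c = (J'†) c' + ((J†) (c - c') + ((J†) c' - (J'†) c')) := by
    rw [map_sub]; abel
  have h2 : ‖(J†) (c - c')‖ ≤ M * εc := (norm_adjoint_apply_le hJ _).trans (by gcongr)
  have h3 : ‖(J†) c' - (J'†) c'‖ ≤ εJ * C := (norm_adjoint_sub_apply_le hJJ _).trans (by gcongr)
  have h4 : ‖(J†) c‖ ≤ ‖(J'†) c'‖ + (M * εc + εJ * C) := by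
    rw [h1]
    exact (norm_add_le _ _).trans (by gcongr; exact (norm_add_le _ _).trans (by gcongr))
  rw [← mul_add]
  gcongr

theorem IsNormalStep.exists_near {c c' : Vec q} {J J' : ZVec n q →L[ℝ] Vec q}
    {v : ZVec n q} {ω a M C εc εJ : ℝ} (hω : 0 ≤ ω) (ha : 0 < a)
    (hv : IsNormalStep ω c J v) (hJa : ∀ y, a * ‖y‖ ≤ ‖(J†) y‖)
    (hc : ‖c‖ ≤ C) (hc' : ‖c'‖ ≤ C) (hJ : ‖J‖ ≤ M)
    (hcc : ‖c - c'‖ ≤ εc) (hJJ : ‖J - J'‖ ≤ εJ) :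
    ∃ w ∈ range (J'†), ‖w‖ ≤ ω * ‖(J'†) c'‖ ∧ ‖w - v‖ ≤ normalDist ω a M C εc εJ := by
  have hM : 0 ≤ M := (norm_nonneg J).trans hJ
  have hεJ : 0 ≤ εJ := (norm_nonneg _).trans hJJ
  have hεc : 0 ≤ εc := (norm_nonneg _).trans hcc
  have hC : 0 ≤ C := (norm_nonneg _).trans hc
  exact exists_mem_range_adjoint_near ha hJa hJJ hv.2.1 (hv.norm_le hω hJ hc) (by positivity)
    (by positivity) (hv.2.2.trans (radius_sub_le hω hc' hJ hcc hJJ))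

theorem norm_residual_sub_le {c c' : Vec q} {J J' : ZVec n q →L[ℝ] Vec q} {v w : ZVec n q}
    {M η V εc εJ : ℝ} (hJ' : ‖J'‖ ≤ M) (hv : ‖v‖ ≤ V) (hw : ‖w - v‖ ≤ η)
    (hcc : ‖c - c'‖ ≤ εc) (hJJ : ‖J - J'‖ ≤ εJ) :
    ‖c' + J' w‖ ≤ ‖c + J v‖ + (εc + M * η + εJ * V) := by
  have hM : 0 ≤ M := (norm_nonneg J').trans hJ'
  have hεJ : 0 ≤ εJ := (norm_nonneg _).trans hJJ
  have h1 : c' + J' w = (c + J v) + ((c' - c) + J' (w - v) + (J' - J) v) := by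
    simp only [map_sub, sub_apply]; abel
  rw [norm_sub_rev] at hcc hJJ
  rw [h1]
  refine (norm_add_le _ _).trans ?_
  gcongr
  refine (norm_add₃_le).trans ?_
  gcongr
  · exact (J'.le_opNorm _).trans (by gcongr)
  · exact ((J' - J).le_opNorm _).trans (by gcongr)

/-- Stability of the normal step. -/
theorem IsNormalStep.norm_sub_le {c c' : Vec q} {J J' : ZVec n q →L[ℝ] Vec q}
    {v v' : ZVec n q} {ω a M C εc εJ : ℝ} (hω : 0 ≤ ω) (ha : 0 < a)
    (hv : IsNormalStep ω c J v) (hv' : IsNormalStep ω c' J' v')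
    (hJa : ∀ y, a * ‖y‖ ≤ ‖(J†) y‖) (hJa' : ∀ y, a * ‖y‖ ≤ ‖(J'†) y‖)
    (hc : ‖c‖ ≤ C) (hc' : ‖c'‖ ≤ C) (hJ : ‖J‖ ≤ M) (hJ' : ‖J'‖ ≤ M)
    (hcc : ‖c - c'‖ ≤ εc) (hJJ : ‖J - J'‖ ≤ εJ) :
    ‖v - v'‖ ≤ normalBound ω a M C εc εJ := by
  have hM : 0 ≤ M := (norm_nonneg J).trans hJ
  have hεJ : 0 ≤ εJ := (norm_nonneg _).trans hJJ
  have hεc : 0 ≤ εc := (norm_nonneg _).trans hcc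
  have hC : 0 ≤ C := (norm_nonneg _).trans hc
  have hcc' := hcc
  have hJJ' := hJJ
  rw [norm_sub_rev] at hcc' hJJ'
  obtain ⟨w', hw'r, hw'n, hw'd⟩ := hv.exists_near hω ha hJa hc hc' hJ hcc hJJ
  obtain ⟨w, hwr, hwn, hwd⟩ := hv'.exists_near hω ha hJa' hc' hc hJ' hcc' hJJ'
  have r1 := norm_residual_sub_le hJ' (hv.norm_le hω hJ hc) hw'd hcc hJJ
  have r2 := norm_residual_sub_le hJ (hv'.norm_le hω hJ' hc') hwd hcc' hJJ'
  have r3 := hv'.norm_residual_le hw'r hw'n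
  have r4 : ‖c + J v‖ ≤ C := by
    have := hv.norm_residual_le (w := 0) ⟨0, map_zero _⟩ (by rw [norm_zero]; positivity)
    rw [map_zero, add_zero] at this
    exact this.trans hc
  have hρ : 0 ≤ residualDist ω a M C εc εJ := by
    unfold residualDist normalDist; positivity
  change _ ≤ _ + residualDist ω a M C εc εJ at r1 r2
  have r5 := hv.sq_norm_apply_sub_le hwr hwn
  unfold normalBound
  set ρ := residualDist ω a M C εc εJ
  have r6 : ‖c + J w‖ ≤ ‖c + J v‖ + 2 * ρ := by linarith
  have r7 : ‖c + J w‖ ^ 2 ≤ (‖c + J v‖ + 2 * ρ) ^ 2 := by gcongr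
  have r8 : ‖J (w - v)‖ ^ 2 ≤ 8 * ρ * (ρ + C) := by
    nlinarith [mul_le_mul_of_nonneg_left r4 hρ]
  have r9 : a * ‖w - v‖ ≤ ‖J (w - v)‖ := by
    obtain ⟨y, hy⟩ := hwr
    obtain ⟨z, hz⟩ := hv.2.1
    rw [← hy, ← hz, ← map_sub]
    exact le_norm_apply_adjoint hJa _
  have r10 : ‖w - v‖ ≤ √(8 * ρ * (ρ + C)) / a := by
    rw [le_div_iff₀ ha, mul_comm]
    exact r9.trans (Real.le_sqrt_of_sq_le r8)
  have r11 := norm_sub_le_norm_sub_add_norm_sub v w v'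
  rw [norm_sub_rev v w] at r11
  linarith

/-! ### The tangential step -/

theorem norm_tangential_le {W : ZVec n q →L[ℝ] ZVec n q} {J : ZVec n q →L[ℝ] Vec q}
    {g v d : ZVec n q} {y : Vec q} (h : SolvesNewton W J g v d y) {σ κ G V : ℝ} (hσ : 0 < σ)
    (hpos : ∀ p, J p = 0 → σ * ‖p‖ ^ 2 ≤ ⟪p, W p⟫_ℝ) (hW : ‖W‖ ≤ κ) (hg : ‖g‖ ≤ G)
    (hv : ‖v‖ ≤ V) : ‖d - v‖ ≤ (G + κ * V) / σ := by
  have hκ : 0 ≤ κ := (norm_nonneg W).trans hW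
  have hJ : J (d - v) = 0 := by rw [map_sub, h.2, sub_self]
  have h1 := hpos _ hJ
  have h2 : W (d - v) = -(g + W v) - (J†) y := by
    rw [map_sub, eq_sub_of_add_eq h.1]; abel
  have h3 : ⟪d - v, (J†) y⟫_ℝ = 0 := by
    rw [ContinuousLinearMap.adjoint_inner_right, hJ, inner_zero_left]
  rw [h2, inner_sub_right, h3, sub_zero, inner_neg_right] at h1
  have h4 : ‖g + W v‖ ≤ G + κ * V := (norm_add_le _ _).trans
    (add_le_add hg ((W.le_opNorm v).trans (by gcongr)))
  have h5 := abs_le.1 (abs_real_inner_le_norm (d - v) (g + W v))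
  have h6 : σ * ‖d - v‖ ^ 2 ≤ ‖d - v‖ * (G + κ * V) :=
    h1.trans ((neg_le.1 h5.1).trans (by gcongr))
  rw [le_div_iff₀ hσ]
  rcases (norm_nonneg (d - v)).eq_or_lt with h0 | h0
  · rw [← h0, zero_mul]; exact (norm_nonneg _).trans h4
  · exact le_of_mul_le_mul_left (by linarith) h0

theorem norm_multiplier_le {W : ZVec n q →L[ℝ] ZVec n q} {J : ZVec n q →L[ℝ] Vec q}
    {g v d : ZVec n q} {y : Vec q} (h : SolvesNewton W J g v d y) {κ G V U a : ℝ}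
    (ha : 0 < a) (hJa : ∀ y, a * ‖y‖ ≤ ‖(J†) y‖) (hW : ‖W‖ ≤ κ) (hg : ‖g‖ ≤ G)
    (hv : ‖v‖ ≤ V) (hu : ‖d - v‖ ≤ U) : ‖y‖ ≤ (G + κ * (U + V)) / a := by
  have hκ : 0 ≤ κ := (norm_nonneg W).trans hW
  have h1 : (J†) y = -(g + W d) := by rw [eq_sub_of_add_eq' h.1]; abel
  have hd : ‖d‖ ≤ U + V := by
    have := norm_add_le (d - v) v
    rw [sub_add_cancel] at this
    linarith
  rw [le_div_iff₀ ha, mul_comm]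
  refine (hJa y).trans ?_
  rw [h1, norm_neg]
  exact (norm_add_le _ _).trans (add_le_add hg ((W.le_opNorm d).trans (by gcongr)))

/-- Bound for the distance between two tangential steps of norm at most `U`, with multipliers of
norm at most `Y` and normal steps at distance at most `εv`. -/
noncomputable def tangentialBound (σ κ a U Y εv εJ εg : ℝ) : ℝ :=
  (εg + κ * εv + εJ * Y + κ * (εJ * U / a)) / σ + 2 * (εJ * U / a)

/-- Stability of the tangential step. -/
theorem norm_tangential_sub_le {W : ZVec n q →L[ℝ] ZVec n q} {J J' : ZVec n q →L[ℝ] Vec q}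
    {g g' v v' d d' : ZVec n q} {y y' : Vec q} (h : SolvesNewton W J g v d y)
    (h' : SolvesNewton W J' g' v' d' y') {σ κ a U Y εv εJ εg : ℝ} (hσ : 0 < σ) (ha : 0 < a)
    (hpos : ∀ p, J p = 0 → σ * ‖p‖ ^ 2 ≤ ⟪p, W p⟫_ℝ) (hW : ‖W‖ ≤ κ)
    (hJa : ∀ y, a * ‖y‖ ≤ ‖(J†) y‖) (hu' : ‖d' - v'‖ ≤ U) (hy' : ‖y'‖ ≤ Y)
    (hgg : ‖g - g'‖ ≤ εg) (hvv : ‖v - v'‖ ≤ εv) (hJJ : ‖J - J'‖ ≤ εJ) :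
    ‖(d - v) - (d' - v')‖ ≤ tangentialBound σ κ a U Y εv εJ εg := by
  have hκ : 0 ≤ κ := (norm_nonneg W).trans hW
  have hεJ : 0 ≤ εJ := (norm_nonneg _).trans hJJ
  have hU : 0 ≤ U := (norm_nonneg _).trans hu'
  have hJu : J (d - v) = 0 := by rw [map_sub, h.2, sub_self]
  have hJu' : J' (d' - v') = 0 := by rw [map_sub, h'.2, sub_self]
  obtain ⟨r, hr, hrn⟩ := exists_preimage_norm_le ha hJa (J (d' - v'))
  have hr' : ‖r‖ ≤ εJ * U / a := by
    rw [le_div_iff₀ ha, mul_comm]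
    refine hrn.trans ?_
    have : J (d' - v') = (J - J') (d' - v') := by
      rw [sub_apply, hJu', sub_zero]
    rw [this]
    exact ((J - J').le_opNorm _).trans (by gcongr)
  set p := (d - v) - (d' - v') + r with hp
  have hJp : J p = 0 := by rw [hp, map_add, map_sub, hJu, hr]; abel
  have hWp : W p = -(g - g') - W (v - v') + W r - (J†) y + (J'†) y' := by
    have e1 := eq_sub_of_add_eq h.1
    have e2 := eq_sub_of_add_eq h'.1
    simp only [hp, map_add, map_sub, e1, e2]
    abel
  have hpy : ⟪p, (J†) y⟫_ℝ = 0 := by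
    rw [ContinuousLinearMap.adjoint_inner_right, hJp, inner_zero_left]
  have hpy' : ⟪p, (J'†) y'⟫_ℝ ≤ ‖p‖ * (εJ * Y) := by
    have e : J' p = -((J - J') p) := by
      rw [sub_apply, hJp, zero_sub, neg_neg]
    rw [ContinuousLinearMap.adjoint_inner_right]
    refine (real_inner_le_norm _ _).trans ?_
    have : ‖J' p‖ ≤ εJ * ‖p‖ := by
      rw [e, norm_neg]; exact ((J - J').le_opNorm _).trans (by gcongr)
    calc ‖J' p‖ * ‖y'‖ ≤ (εJ * ‖p‖) * Y := by gcongr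
      _ = _ := by ring
  have hrest : ‖-(g - g') - W (v - v') + W r‖ ≤ εg + κ * εv + κ * (εJ * U / a) := by
    refine (norm_add_le _ _).trans (add_le_add ((norm_sub_le _ _).trans (add_le_add ?_ ?_)) ?_)
    · rwa [norm_neg]
    · exact (W.le_opNorm _).trans (by gcongr)
    · exact (W.le_opNorm _).trans (by gcongr)
  have h1 := hpos p hJp
  rw [hWp, inner_add_right, inner_sub_right, hpy, sub_zero] at h1
  have h2 := (real_inner_le_norm p (-(g - g') - W (v - v') + W r)).trans
    (mul_le_mul_of_nonneg_left hrest (norm_nonneg p))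
  have hpn : ‖p‖ ≤ (εg + κ * εv + εJ * Y + κ * (εJ * U / a)) / σ := by
    rw [le_div_iff₀ hσ]
    rcases (norm_nonneg p).eq_or_lt with h0 | h0
    · rw [← h0, zero_mul]
      have := (norm_nonneg _).trans hrest
      have := mul_nonneg hεJ ((norm_nonneg _).trans hy')
      linarith
    · exact le_of_mul_le_mul_left (by linarith) h0
  have h3 : (d - v) - (d' - v') = p - r := by rw [hp]; abel
  have h4 := norm_sub_le p r
  have h5 : 0 ≤ εJ * U / a := by positivity
  rw [h3]
  unfold tangentialBound
  linarith

end Steps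

section Iterate

variable {n q : ℕ}

theorem norm_diagOp_le (s : Vec q) : ‖diagOp s‖ ≤ ‖s‖ := by
  refine ContinuousLinearMap.opNorm_le_bound _ (norm_nonneg _) fun y => ?_
  have h : ∀ i, diagOp s y i = s i * y i := fun i => by
    simp [diagOp, Matrix.mulVec_diagonal]
  refine le_of_sq_le_sq ?_ (by positivity)
  rw [mul_pow, EuclideanSpace.real_norm_sq_eq (diagOp s y), EuclideanSpace.real_norm_sq_eq y,
    Finset.mul_sum]
  refine Finset.sum_le_sum fun i _ => ?_
  have h1 : s i ^ 2 ≤ ‖s‖ ^ 2 := by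
    have := PiLp.norm_apply_le s i
    rw [← sq_abs, ← Real.norm_eq_abs]
    gcongr
  rw [h, mul_pow]
  gcongr

theorem norm_comp_fstL_le (A : Vec n →L[ℝ] Vec q) :
    ‖A ∘L WithLp.fstL 2 ℝ (Vec n) (Vec q)‖ ≤ ‖A‖ :=
  ContinuousLinearMap.opNorm_le_bound _ (norm_nonneg _) fun p =>
    (A.le_opNorm _).trans (mul_le_mul_of_nonneg_left (WithLp.norm_fst_le _ p) (norm_nonneg _))

theorem norm_blockRow_le (A : Vec n →L[ℝ] Vec q) (B : Vec q →L[ℝ] Vec q) :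
    ‖blockRow A B‖ ≤ ‖A‖ + ‖B‖ :=
  (norm_add_le _ _).trans (add_le_add (norm_comp_fstL_le A)
    (ContinuousLinearMap.opNorm_le_bound _ (norm_nonneg _) fun p =>
      (B.le_opNorm _).trans (mul_le_mul_of_nonneg_left (WithLp.norm_snd_le _ p) (norm_nonneg _))))

theorem norm_blockRow_sub_le (A A' : Vec n →L[ℝ] Vec q) (B : Vec q →L[ℝ] Vec q) :
    ‖blockRow A B - blockRow A' B‖ ≤ ‖A - A'‖ := by
  have : blockRow A B - blockRow A' B = (A - A') ∘L WithLp.fstL 2 ℝ (Vec n) (Vec q) := by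
    simp [blockRow, ContinuousLinearMap.sub_comp]
  rw [this]
  exact norm_comp_fstL_le _

/-- The gradient `(0, -μ e)` of the scaled barrier term. -/
noncomputable def barrierGrad (n q : ℕ) (μ : ℝ) : ZVec n q :=
  WithLp.toLp 2 (0, WithLp.toLp 2 (fun _ => -μ))

namespace Evals

theorem norm_g_le (F : Evals n q) (μ : ℝ) (x : Vec n) :
    ‖F.g μ x‖ ≤ ‖F.g0 x‖ + ‖barrierGrad n q μ‖ := by
  have : F.g μ x = WithLp.toLp 2 (F.g0 x, (0 : Vec q)) + barrierGrad n q μ := by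
    simp [g, barrierGrad, ← WithLp.toLp_add]
  rw [this]
  refine (norm_add_le _ _).trans ?_
  rw [WithLp.norm_toLp_fst]

theorem norm_g_sub_le (F F' : Evals n q) (μ : ℝ) (x : Vec n) :
    ‖F.g μ x - F'.g μ x‖ ≤ ‖F.g0 x - F'.g0 x‖ := by
  have : F.g μ x - F'.g μ x = WithLp.toLp 2 (F.g0 x - F'.g0 x, (0 : Vec q)) := by
    simp [g, ← WithLp.toLp_sub]
  rw [this, WithLp.norm_toLp_fst]

end Evals

theorem finrank_vec_le : Module.finrank ℝ (Vec q) ≤ Module.finrank ℝ (ZVec n q) := by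
  rw [(WithLp.linearEquiv 2 ℝ (Vec n × Vec q)).finrank_eq, Module.finrank_prod]
  omega

section Bounds

variable {X : Set (Vec n)} {fbar0 : Vec n → ℝ} {cbarI : Vec n → Vec q} {F : Evals n q}
  {it : Iterates n q} {st : NoiselessSteps n q} {P : Params}
  {μ ω cSup gSup JSup sSup εf εg εc εJ σW κW γ : ℝ} {k : ℕ}

namespace RegularWithNoise

theorem norm_c_sub_le (h : RegularWithNoise X fbar0 cbarI F it cSup gSup JSup εf εg εc εJ) :
    ‖it.c F k - it.c (Evals.exact fbar0 cbarI) k‖ ≤ εc := by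
  have : it.c F k - it.c (Evals.exact fbar0 cbarI) k = F.cI (it.x k) - cbarI (it.x k) := by
    simp [Iterates.c, Evals.c, Evals.exact]
  rw [this, norm_sub_rev]
  exact h.c_noise _ (h.mem k)

theorem norm_J_sub_le (h : RegularWithNoise X fbar0 cbarI F it cSup gSup JSup εf εg εc εJ) :
    ‖it.J F k - it.J (Evals.exact fbar0 cbarI) k‖ ≤ εJ := by
  refine (norm_blockRow_sub_le _ _ _).trans ?_
  rw [norm_sub_rev]
  exact h.J_noise _ (h.mem k)

theorem norm_g_sub_le (h : RegularWithNoise X fbar0 cbarI F it cSup gSup JSup εf εg εc εJ) :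
    ‖it.g F μ k - it.g (Evals.exact fbar0 cbarI) μ k‖ ≤ εg := by
  refine (Evals.norm_g_sub_le _ _ _ _).trans ?_
  rw [norm_sub_rev]
  exact h.g_noise _ (h.mem k)

theorem norm_c_exact_le (h : RegularWithNoise X fbar0 cbarI F it cSup gSup JSup εf εg εc εJ)
    (hs : ‖it.s k‖ ≤ sSup) : ‖it.c (Evals.exact fbar0 cbarI) k‖ ≤ cSup + sSup :=
  (norm_add_le _ _).trans (add_le_add (h.c_bound _ (h.mem k)) hs)

theorem norm_J_exact_le (h : RegularWithNoise X fbar0 cbarI F it cSup gSup JSup εf εg εc εJ)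
    (hs : ‖it.s k‖ ≤ sSup) : ‖it.J (Evals.exact fbar0 cbarI) k‖ ≤ JSup + sSup :=
  (norm_blockRow_le _ _).trans
    (add_le_add (h.J_bound _ (h.mem k)) ((norm_diagOp_le _).trans hs))

theorem norm_g_exact_le (h : RegularWithNoise X fbar0 cbarI F it cSup gSup JSup εf εg εc εJ) :
    ‖it.g (Evals.exact fbar0 cbarI) μ k‖ ≤ gSup + ‖barrierGrad n q μ‖ :=
  (Evals.norm_g_le _ _ _).trans (by gcongr; exact h.g_bound _ (h.mem k))

end RegularWithNoise

theorem norm_le_add_of_norm_sub_le {E : Type*} [SeminormedAddCommGroup E] {a b : E} {A ε : ℝ}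
    (hb : ‖b‖ ≤ A) (h : ‖a - b‖ ≤ ε) : ‖a‖ ≤ A + ε := by
  have := norm_sub_norm_le a b
  linarith

/-- If the adjoint of `T` is bounded below by `γ`, so is that of any `S` near `T`, by `γ / 2`. -/
theorem half_mul_le_norm_adjoint {T S : ZVec n q →L[ℝ] Vec q} (hT : ∀ y, γ * ‖y‖ ≤ ‖(T†) y‖)
    {ε : ℝ} (h : ‖T - S‖ ≤ ε) (hε : ε ≤ γ / 2) (y : Vec q) : γ / 2 * ‖y‖ ≤ ‖(S†) y‖ := by
  have h1 := norm_sub_norm_le ((T†) y) ((S†) y)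
  have h2 := norm_adjoint_sub_apply_le h y
  have h3 := mul_le_mul_of_nonneg_right hε (norm_nonneg y)
  linarith [hT y]

theorem le_two_mul_div {V : ℝ} (hV : 0 ≤ V) (hγ : 0 < γ) (h : γ / 2 ≤ εJ) :
    2 * V ≤ 2 * (εJ * V / (γ / 2)) := by
  rw [mul_le_mul_iff_right₀ two_pos, le_div_iff₀ (by positivity), mul_comm]
  gcongr

/-- The bound for the deviation of the normal step in terms of the noise levels. -/
noncomputable def epsV (ω cSup JSup sSup γ : ℝ) (e : ℝ × ℝ) : ℝ :=
  |normalBound ω (γ / 2) (JSup + sSup + e.2) (cSup + sSup + e.1) e.1 e.2|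

/-- Bound for the normal steps. -/
noncomputable def supV (ω cSup JSup sSup εc εJ : ℝ) : ℝ :=
  ω * ((JSup + sSup + εJ) * (cSup + sSup + εc))

/-- Bound for the scaled gradients. -/
noncomputable def supG (n q : ℕ) (μ gSup εg : ℝ) : ℝ := gSup + ‖barrierGrad n q μ‖ + εg

/-- Bound for the tangential steps. -/
noncomputable def supU (n q : ℕ) (μ ω cSup gSup JSup sSup σW κW εc εJ εg : ℝ) : ℝ :=
  (supG n q μ gSup εg + κW * supV ω cSup JSup sSup εc εJ) / σW

/-- Bound for the multipliers. -/
noncomputable def supY (n q : ℕ) (μ ω cSup gSup JSup sSup σW κW γ εc εJ εg : ℝ) : ℝ :=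
  (supG n q μ gSup εg + κW * (supU n q μ ω cSup gSup JSup sSup σW κW εc εJ εg +
    supV ω cSup JSup sSup εc εJ)) / (γ / 2)

/-- The bound for the deviation of the tangential step in terms of the noise levels. -/
noncomputable def epsU (n q : ℕ) (μ ω cSup gSup JSup sSup σW κW γ : ℝ) (e : ℝ × ℝ × ℝ) : ℝ :=
  |tangentialBound σW κW (γ / 2) (supU n q μ ω cSup gSup JSup sSup σW κW e.1 e.2.1 e.2.2)
    (supY n q μ ω cSup gSup JSup sSup σW κW γ e.1 e.2.1 e.2.2)
    (epsV ω cSup JSup sSup γ (e.1, e.2.1)) e.2.1 e.2.2|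

theorem tendsto_epsV : Tendsto (epsV ω cSup JSup sSup γ) (𝓝 (0, 0)) (𝓝 0) := by
  have hc : Continuous (epsV ω cSup JSup sSup γ) := by
    unfold epsV normalBound residualDist normalDist
    fun_prop
  have h := hc.tendsto (0, 0)
  have h0 : epsV ω cSup JSup sSup γ (0, 0) = 0 := by
    simp [epsV, normalBound, residualDist, normalDist]
  rwa [h0] at h

theorem tendsto_epsU :
    Tendsto (epsU n q μ ω cSup gSup JSup sSup σW κW γ) (𝓝 (0, 0, 0)) (𝓝 0) := by
  have hc : Continuous (epsU n q μ ω cSup gSup JSup sSup σW κW γ) := by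
    unfold epsU tangentialBound supY supU supG supV epsV normalBound residualDist normalDist
    fun_prop
  have h := hc.tendsto (0, 0, 0)
  have h0 : epsU n q μ ω cSup gSup JSup sSup σW κW γ (0, 0, 0) = 0 := by
    simp [epsU, tangentialBound, epsV, normalBound, residualDist, normalDist]
  rwa [h0] at h

theorem Iterates.IsRun.norm_normal_le (hrun : it.IsRun F P μ ω εf εc)
    (hreg : RegularWithNoise X fbar0 cbarI F it cSup gSup JSup εf εg εc εJ) (hω : 0 < ω)
    (hs : ‖it.s k‖ ≤ sSup) : ‖it.v k‖ ≤ supV ω cSup JSup sSup εc εJ :=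
  (hrun.normal k).norm_le hω.le
    (norm_le_add_of_norm_sub_le (hreg.norm_J_exact_le hs) hreg.norm_J_sub_le)
    (norm_le_add_of_norm_sub_le (hreg.norm_c_exact_le hs) hreg.norm_c_sub_le)

theorem NoiselessSteps.AreFor.norm_normal_le
    (hst : st.AreFor it (Evals.exact fbar0 cbarI) μ ω)
    (hreg : RegularWithNoise X fbar0 cbarI F it cSup gSup JSup εf εg εc εJ) (hω : 0 < ω)
    (hεc : 0 < εc) (hεJ : 0 < εJ)
    (hs : ‖it.s k‖ ≤ sSup) : ‖st.v k‖ ≤ supV ω cSup JSup sSup εc εJ :=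
  (hst.normal k).norm_le hω.le
    ((hreg.norm_J_exact_le hs).trans (le_add_of_nonneg_right hεJ.le))
    ((hreg.norm_c_exact_le hs).trans (le_add_of_nonneg_right hεc.le))

theorem norm_normal_sub_le (hω : 0 < ω) (hγ : 0 < γ) (hεc : 0 < εc) (hεJ : 0 < εJ)
    (hrun : it.IsRun F P μ ω εf εc) (hst : st.AreFor it (Evals.exact fbar0 cbarI) μ ω)
    (hreg : RegularWithNoise X fbar0 cbarI F it cSup gSup JSup εf εg εc εJ)
    (hs : ‖it.s k‖ ≤ sSup) (hJ : SigmaMinGE (it.J F k) γ) :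
    ‖st.v k - it.v k‖ ≤ epsV ω cSup JSup sSup γ (εc, εJ) := by
  have hJa := hJ.le_norm_adjoint hγ finrank_vec_le
  have hC := hreg.norm_c_exact_le hs
  have hM := hreg.norm_J_exact_le hs
  refine le_trans ?_ (le_abs_self _)
  rw [norm_sub_rev]
  rcases le_total εJ (γ / 2) with h | h
  · refine (hrun.normal k).norm_sub_le hω.le (half_pos hγ) (hst.normal k)
      (fun y => le_trans (by gcongr; linarith) (hJa y))
      (half_mul_le_norm_adjoint hJa hreg.norm_J_sub_le h)
      (norm_le_add_of_norm_sub_le hC hreg.norm_c_sub_le)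
      (hC.trans (le_add_of_nonneg_right hεc.le))
      (norm_le_add_of_norm_sub_le hM hreg.norm_J_sub_le)
      (hM.trans (le_add_of_nonneg_right hεJ.le)) hreg.norm_c_sub_le hreg.norm_J_sub_le
  · have h1 := hrun.norm_normal_le hreg hω hs
    have h2 := hst.norm_normal_le hreg hω hεc hεJ hs
    have h3 := le_two_mul_div ((norm_nonneg _).trans h1) hγ h
    have h4 := norm_sub_le (it.v k) (st.v k)
    have hC0 := (norm_nonneg _).trans hC
    have hM0 := (norm_nonneg _).trans hM
    have h5 : 0 ≤ ω * ((JSup + sSup + εJ) * εc + εJ * (cSup + sSup + εc)) := by positivity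
    unfold normalBound
    refine le_trans ?_ (le_add_of_nonneg_right (by positivity))
    unfold normalDist
    unfold supV at h1 h2 h3
    dsimp only
    linarith

theorem norm_tangential_sub_le_epsU (hω : 0 < ω) (hσW : 0 < σW) (hγ : 0 < γ) (hεg : 0 < εg)
    (hεc : 0 < εc) (hεJ : 0 < εJ) (hrun : it.IsRun F P μ ω εf εc)
    (hst : st.AreFor it (Evals.exact fbar0 cbarI) μ ω)
    (hreg : RegularWithNoise X fbar0 cbarI F it cSup gSup JSup εf εg εc εJ)
    (hmat : MatricesOK F (Evals.exact fbar0 cbarI) it st μ σW κW)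
    (hs : ‖it.s k‖ ≤ sSup) (hJ : SigmaMinGE (it.J F k) γ) :
    ‖it.u k - st.u k‖ ≤ epsU n q μ ω cSup gSup JSup sSup σW κW γ (εc, εJ, εg) := by
  have hJa := hJ.le_norm_adjoint hγ finrank_vec_le
  have hκ : 0 ≤ κW := (norm_nonneg _).trans (hmat.norm_le k)
  have hv := hrun.norm_normal_le hreg hω hs
  have hv' := hst.norm_normal_le hreg hω hεc hεJ hs
  have hvv := norm_normal_sub_le hω hγ hεc hεJ hrun hst hreg hs hJ
  rw [norm_sub_rev] at hvv
  have hg' : ‖it.g (Evals.exact fbar0 cbarI) μ k‖ ≤ supG n q μ gSup εg :=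
    hreg.norm_g_exact_le.trans (le_add_of_nonneg_right hεg.le)
  have hg : ‖it.g F μ k‖ ≤ supG n q μ gSup εg :=
    norm_le_add_of_norm_sub_le hreg.norm_g_exact_le hreg.norm_g_sub_le
  have hu := norm_tangential_le (hrun.newton k) hσW
    (fun p hp => hmat.pos_null k p (Or.inl hp)) (hmat.norm_le k) hg hv
  have hu' := norm_tangential_le (hst.newton k) hσW
    (fun p hp => hmat.pos_null k p (Or.inr hp)) (hmat.norm_le k) hg' hv'
  refine le_trans ?_ (le_abs_self _)
  rcases le_total εJ (γ / 2) with h | h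
  · have hy' := norm_multiplier_le (hst.newton k) (half_pos hγ)
      (half_mul_le_norm_adjoint hJa hreg.norm_J_sub_le h) (hmat.norm_le k) hg' hv' hu'
    exact norm_tangential_sub_le (hrun.newton k) (hst.newton k) hσW (half_pos hγ)
      (fun p hp => hmat.pos_null k p (Or.inl hp)) (hmat.norm_le k)
      (fun y => le_trans (by gcongr; linarith) (hJa y)) hu' hy' hreg.norm_g_sub_le hvv
      hreg.norm_J_sub_le
  · have hU := (norm_nonneg _).trans hu
    have h3 := le_two_mul_div hU hγ h
    have h4 := norm_sub_le (it.u k) (st.u k)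
    have hG := (norm_nonneg _).trans hg
    have hV := (norm_nonneg _).trans hv
    have hεv := (norm_nonneg _).trans hvv
    have hY : 0 ≤ supY n q μ ω cSup gSup JSup sSup σW κW γ εc εJ εg := by
      unfold supY supU; positivity
    unfold tangentialBound
    change 0 ≤ supU n q μ ω cSup gSup JSup sSup σW κW εc εJ εg at hU
    refine le_trans ?_ (le_add_of_nonneg_left (by positivity))
    unfold supU
    unfold Iterates.u NoiselessSteps.u at h4 ⊢
    dsimp only
    linarith

end Bounds

end Iterate

end NoisyIPM

theorem mainTheorem3 (n q : ℕ) (μ ω cSup gSup JSup sSup σW κW γ : ℝ)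
    (hμ : 0 < μ) (hω : 0 < ω) (hcSup : 0 < cSup) (hgSup : 0 < gSup) (hJSup : 0 < JSup)
    (hsSup : 0 < sSup) (hσW : 0 < σW) (hκW : 0 < κW) (hγ : 0 < γ) :
    ∃ (εv : ℝ × ℝ → ℝ) (εu εd : ℝ × ℝ × ℝ → ℝ),
      (∀ e, 0 ≤ εv e) ∧ (∀ e, 0 ≤ εu e) ∧ (∀ e, 0 ≤ εd e) ∧
      Tendsto εv (𝓝[Ioi 0 ×ˢ Ioi 0] (0, 0)) (𝓝 0) ∧
      Tendsto εu (𝓝[Ioi 0 ×ˢ Ioi 0 ×ˢ Ioi 0] (0, 0, 0)) (𝓝 0) ∧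
      Tendsto εd (𝓝[Ioi 0 ×ˢ Ioi 0 ×ˢ Ioi 0] (0, 0, 0)) (𝓝 0) ∧
      (∀ εc εJ εg : ℝ, εd (εc, εJ, εg) = εv (εc, εJ) + εu (εc, εJ, εg)) ∧
      ∀ (fbar0 : NoisyIPM.Vec n → ℝ) (cbarI : NoisyIPM.Vec n → NoisyIPM.Vec q)
        (X : Set (NoisyIPM.Vec n)) (F : NoisyIPM.Evals n q) (P : NoisyIPM.Params)
        (it : NoisyIPM.Iterates n q) (st : NoisyIPM.NoiselessSteps n q)
        (εf εg εc εJ : ℝ) (kJ : ℕ),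
        0 < εf → 0 < εg → 0 < εc → 0 < εJ → εJ < γ →
        it.IsRun F P μ ω εf εc →
        st.AreFor it (NoisyIPM.Evals.exact fbar0 cbarI) μ ω →
        NoisyIPM.RegularWithNoise X fbar0 cbarI F it cSup gSup JSup εf εg εc εJ →
        NoisyIPM.MatricesOK F (NoisyIPM.Evals.exact fbar0 cbarI) it st μ σW κW →
        (∀ k, ‖it.s k‖ ≤ sSup) →
        (∀ k ≥ kJ, NoisyIPM.SigmaMinGE (it.J F k) γ) →
        (∀ k ≥ kJ, ‖st.v k - it.v k‖ ≤ εv (εc, εJ)) ∧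
        (NoisyIPM.SmallJacobianNoise F (NoisyIPM.Evals.exact fbar0 cbarI) it εJ kJ →
          (∀ k ≥ kJ, ‖it.u k - st.u k‖ ≤ εu (εc, εJ, εg)) ∧
          (∀ k ≥ kJ, ‖it.d k - st.d k‖ ≤ εd (εc, εJ, εg))) := by
  refine ⟨NoisyIPM.epsV ω cSup JSup sSup γ, NoisyIPM.epsU n q μ ω cSup gSup JSup sSup σW κW γ,
    fun e => NoisyIPM.epsV ω cSup JSup sSup γ (e.1, e.2.1) +
      NoisyIPM.epsU n q μ ω cSup gSup JSup sSup σW κW γ e,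
    fun _ => abs_nonneg _, fun _ => abs_nonneg _,
    fun _ => add_nonneg (abs_nonneg _) (abs_nonneg _),
    NoisyIPM.tendsto_epsV.mono_left nhdsWithin_le_nhds,
    NoisyIPM.tendsto_epsU.mono_left nhdsWithin_le_nhds, ?_, fun _ _ _ => rfl, ?_⟩
  · have h1 : Tendsto (fun e : ℝ × ℝ × ℝ => (e.1, e.2.1)) (𝓝 (0, 0, 0)) (𝓝 (0, 0)) :=
      Continuous.tendsto (f := fun e : ℝ × ℝ × ℝ => (e.1, e.2.1)) (by fun_prop) (0, 0, 0)
    have h2 := (NoisyIPM.tendsto_epsV (ω := ω) (cSup := cSup) (JSup := JSup) (sSup := sSup)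
      (γ := γ)).comp h1
    have h3 := h2.add (NoisyIPM.tendsto_epsU (n := n) (q := q) (μ := μ) (ω := ω) (cSup := cSup)
      (gSup := gSup) (JSup := JSup) (sSup := sSup) (σW := σW) (κW := κW) (γ := γ))
    rw [add_zero] at h3
    exact h3.mono_left nhdsWithin_le_nhds
  · intro fbar0 cbarI X F P it st εf εg εc εJ kJ _ hεg hεc hεJ _ hrun hst hreg hmat hs hJ
    have hv : ∀ k ≥ kJ, ‖st.v k - it.v k‖ ≤ NoisyIPM.epsV ω cSup JSup sSup γ (εc, εJ) :=
      fun k hk => NoisyIPM.norm_normal_sub_le hω hγ hεc hεJ hrun hst hreg (hs k) (hJ k hk)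
    have hu : ∀ k ≥ kJ, ‖it.u k - st.u k‖ ≤
        NoisyIPM.epsU n q μ ω cSup gSup JSup sSup σW κW γ (εc, εJ, εg) :=
      fun k hk => NoisyIPM.norm_tangential_sub_le_epsU hω hσW hγ hεg hεc hεJ hrun hst hreg hmat
        (hs k) (hJ k hk)
    refine ⟨hv, fun _ => ⟨hu, fun k hk => ?_⟩⟩
    have h1 : it.d k - st.d k = (it.v k - st.v k) + (it.u k - st.u k) := by
      rw [NoisyIPM.Iterates.u, NoisyIPM.NoiselessSteps.u]; abel
    have h2 := hv k hk
    rw [norm_sub_rev] at h2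
    rw [h1]
    exact (norm_add_le _ _).trans (add_le_add h2 (hu k hk))
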